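/- Let $n\ge 0$ and let $\mathbb R^n$ carry the Euclidean norm $\|\cdot\|$ and inner product $\langle\cdot,\cdot\rangle$. For $e\in\mathbb R^n\setminus\{0\}$ and $\alpha\in(0,1]$ let $C_{e,\alpha}=\{v\in\mathbb R^n:\langle v,e\rangle\ge\alpha\|v\|\|e\|\}$ and let $\Gamma_{e,\alpha}$ be the set of Lipschitz curves $\gamma:\mathbb R\to\mathbb R^n$ with $\gamma'(t)\in C_{e,\alpha}$ for almost every $t\in\mathbb R$. For an open set $G\subset\mathbb R^n$ put $w_{e,\alpha}(G)=\sup\{\mathcal H^1(G\cap\gamma(\mathbb R)):\gamma\in\Gamma_{e,\alpha}\}$, where $\mathcal H^1$ is the one-dimensional Hausdorff measure, and for an arbitrary $A\subset\mathbb R^n$ put $w_{e,\alpha}(A)=\inf\{w_{e,\alpha}(G):G\supset A,\ G\text{ open}\}$; if $e=0$ or $\alpha>1$, put $w_{e,\alpha}(A)=0$ for every $A$. For $x\in E\subset\mathbb R^n$ let $$\mathcal N(E,x)=\{e\in\mathbb R^n:\ \text{for every }\varepsilon>0\text{ there is }r>0\text{ with }w_{e,\varepsilon}(B(x,r)\cap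 E)=0\},$$ where $B(x,r)$ is the open ball. The set $E$ is called uniformly purely unrectifiable if $\mathcal N(E,x)=\mathbb R^n$ for every $x\in E$. Theorem. For every uniformly purely unrectifiable set $E\subset\mathbb R^n$ there is a $1$-Lipschitz function $f:\mathbb R^n\to\mathbb R$ such that $$\liminf_{r\searrow0}\ \sup_{\|y\|\le r}\frac{|f(x+y)-f(x)-\langle e,y\rangle|}{r}=0$$ for every $x\in E$ and every $e\in\mathbb R^n$ with $\|e\|\le1$. In particular, for every $x\in E$ and $y\in\mathbb R^n$, $$\limsup_{t\searrow0}\frac{f(x+ty)-f(x)}{t}=\|y\|\quad\text{and}\quad\liminf_{t\searrow0}\frac{f(x+ty)-f(x)}{t}=-\|y\|.$$ -/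

import Mathlib

namespace ConeWidth

open MeasureTheory Filter Topology Set
open scoped ENNReal

/-- The closed cone `C_{e,α} = {v : ⟨v, e⟩ ≥ α ‖v‖ ‖e‖}`. -/
def cone {n : ℕ} (e : EuclideanSpace ℝ (Fin n)) (α : ℝ) : Set (EuclideanSpace ℝ (Fin n)) :=
  {v | α * ‖v‖ * ‖e‖ ≤ inner ℝ v e}

/-- The set `Γ_{e,α}` of Lipschitz curves `γ : ℝ → ℝⁿ` such that, for almost every `t`, the
derivative `γ'(t)` exists and belongs to `C_{e,α}`. -/
def coneCurves {n : ℕ} (e : EuclideanSpace ℝ (Fin n)) (α : ℝ) :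
    Set (ℝ → EuclideanSpace ℝ (Fin n)) :=
  {γ | (∃ K, LipschitzWith K γ) ∧
    ∀ᵐ t ∂(volume : Measure ℝ), ∃ v ∈ cone e α, HasDerivAt γ v t}

/-- The supremum of `ℋ¹(G ∩ γ(ℝ))` over all `γ ∈ Γ_{e,α}`: the `(e,α)`-width of an open set `G`. -/
noncomputable def openWidth {n : ℕ} (e : EuclideanSpace ℝ (Fin n)) (α : ℝ)
    (G : Set (EuclideanSpace ℝ (Fin n))) : ℝ≥0∞ :=
  ⨆ γ ∈ coneCurves e α, Measure.hausdorffMeasure 1 (G ∩ range γ)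

open scoped Classical in
/-- The `(e,α)`-width `w_{e,α}(E)` of an arbitrary set `E`: the infimum of the widths of the open
sets containing `E`. By convention it is `0` when `e = 0` or `α > 1`. -/
noncomputable def width {n : ℕ} (e : EuclideanSpace ℝ (Fin n)) (α : ℝ)
    (E : Set (EuclideanSpace ℝ (Fin n))) : ℝ≥0∞ :=
  if e = 0 ∨ 1 < α then 0
  else ⨅ (G : Set (EuclideanSpace ℝ (Fin n))) (_ : IsOpen G) (_ : E ⊆ G), openWidth e α G

/-- The set `𝒩(E,x)` of all `e` such that for every `ε > 0` there is `r > 0` with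
`w_{e,ε}(B(x,r) ∩ E) = 0`. -/
def normalSet {n : ℕ} (E : Set (EuclideanSpace ℝ (Fin n))) (x : EuclideanSpace ℝ (Fin n)) :
    Set (EuclideanSpace ℝ (Fin n)) :=
  {e | ∀ ε : ℝ, 0 < ε → ∃ r : ℝ, 0 < r ∧ width e ε (Metric.ball x r ∩ E) = 0}

/-- `E` is uniformly purely unrectifiable: `𝒩(E,x) = ℝⁿ` for every `x ∈ E`. -/
def UniformlyPurelyUnrectifiable {n : ℕ} (E : Set (EuclideanSpace ℝ (Fin n))) : Prop :=
  ∀ x ∈ E, normalSet E x = univ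

/-- `sup_{‖y‖ ≤ r} |f(x+y) - f(x) - ⟨e, y⟩| / r`, a value in `[0,∞]` (used for `r > 0`). -/
noncomputable def linearApproxError {n : ℕ} (f : EuclideanSpace ℝ (Fin n) → ℝ)
    (x e : EuclideanSpace ℝ (Fin n)) (r : ℝ) : ℝ≥0∞ :=
  ⨆ (y : EuclideanSpace ℝ (Fin n)) (_ : ‖y‖ ≤ r),
    ENNReal.ofReal (|f (x + y) - f x - inner ℝ e y| / r)

/-- The upper directional derivative `D⁺f(x;y)`, a value in `[-∞,∞]`. -/
noncomputable def upperDirDeriv {n : ℕ} (f : EuclideanSpace ℝ (Fin n) → ℝ)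
    (x y : EuclideanSpace ℝ (Fin n)) : EReal :=
  limsup (fun t : ℝ => (((f (x + t • y) - f x) / t : ℝ) : EReal)) (𝓝[>] (0 : ℝ))

/-- The lower directional derivative `D₊f(x;y)`, a value in `[-∞,∞]`. -/
noncomputable def lowerDirDeriv {n : ℕ} (f : EuclideanSpace ℝ (Fin n) → ℝ)
    (x y : EuclideanSpace ℝ (Fin n)) : EReal :=
  liminf (fun t : ℝ => (((f (x + t • y) - f x) / t : ℝ) : EReal)) (𝓝[>] (0 : ℝ))

end ConeWidth

namespace ConeWidth

open MeasureTheory Filter Topology Set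
open scoped ENNReal

variable {n : ℕ}

local notation "𝔼" n => EuclideanSpace ℝ (Fin n)

/-! ### Uniformly purely unrectifiable sets have width zero -/

/-! The hypothesis makes `E` almost invisible to curves: for every unit vector `e` and every
aperture there is an open `G ⊇ E` in which each curve of the cone has length at most `η`. The
largest length in `G` collected on the way to `x`, suitably penalized, is a function with values in
`[0, η]` and slope one along `e` in `G`. A wide cone is nearly a half-space, so this function hardly
decreases in directions orthogonal to `e` and looks like `⟨·, e⟩` near `E` (`exists_potential`).
Thus arbitrarily small functions can have a prescribed slope near `E`.

Subtracting such functions from the coordinates gives a map `Φ` close to the identity with small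
Lipschitz constant near each point of `E`. Then `f ∘ Φ` is nearly flat there, and adding one more
potential produces any admissible slope `e`, while the Lipschitz constant grows only slightly
(`exists_nearlyAffineAt`). Iteration with constants increasing to `1`, and slopes that return
infinitely often to each member of a dense set of directions, converges to the required function.
The scale on which a step is nearly affine depends on the point, so later corrections are bounded by
`1`-Lipschitz functions `τ`, positive on `E`, instead of by constants (`exists_potential_le`,
`exists_step`). -/

theorem openWidth_iUnion_le {ι : Type*} [Countable ι] (e : 𝔼 n) (α : ℝ) (G : ι → Set (𝔼 n)) :
    openWidth e α (⋃ i, G i) ≤ ∑' i, openWidth e α (G i) := by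
  refine iSup₂_le fun γ hγ => ?_
  rw [iUnion_inter]
  refine (measure_iUnion_le _).trans (ENNReal.tsum_le_tsum fun i => ?_)
  exact le_iSup₂ (f := fun γ (_ : γ ∈ coneCurves e α) =>
    Measure.hausdorffMeasure 1 (G i ∩ range γ)) γ hγ

theorem exists_open_openWidth_lt {e : 𝔼 n} {α : ℝ} {A : Set (𝔼 n)} (he : e ≠ 0) (hα : α ≤ 1)
    (h : width e α A = 0) {η : ℝ≥0∞} (hη : 0 < η) :
    ∃ G, IsOpen G ∧ A ⊆ G ∧ openWidth e α G < η := by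
  have hc : ¬ (e = 0 ∨ 1 < α) := by simp [he, hα]
  rw [width, if_neg hc] at h
  have h' := h.trans_lt hη
  simpa only [iInf_lt_iff, exists_prop] using h'

/-- By the Lindelöf property countably many of the balls cover `E`; countable subadditivity of the
width of open sets then glues the local covers. -/
theorem UniformlyPurelyUnrectifiable.exists_open_openWidth_le {E : Set (𝔼 n)}
    (hE : UniformlyPurelyUnrectifiable E) {e : 𝔼 n} (he : e ≠ 0) {α : ℝ} (hα0 : 0 < α)
    (hα : α ≤ 1) {η : ℝ} (hη : 0 < η) :
    ∃ G, IsOpen G ∧ E ⊆ G ∧ openWidth e α G ≤ ENNReal.ofReal η := by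
  have h : ∀ x ∈ E, ∃ r : ℝ, 0 < r ∧ width e α (Metric.ball x r ∩ E) = 0 := by
    intro x hx
    have : e ∈ normalSet E x := by rw [hE x hx]; trivial
    exact this α hα0
  choose! r hr hw using h
  obtain ⟨t, htE, htc, ht⟩ := TopologicalSpace.countable_cover_nhdsWithin
    (f := fun x => Metric.ball x (r x)) (s := E)
    (fun x hx => mem_nhdsWithin_of_mem_nhds (Metric.ball_mem_nhds x (hr x hx)))
  have : Countable t := htc.to_subtype
  obtain ⟨δ, hδ0, hδ⟩ := ENNReal.exists_pos_sum_of_countable'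
    (ENNReal.ofReal_pos.2 hη).ne' t
  have hG : ∀ x : t, ∃ G, IsOpen G ∧ Metric.ball (x : 𝔼 n) (r x) ∩ E ⊆ G ∧
      openWidth e α G < δ x := fun x =>
    exists_open_openWidth_lt he hα (hw x (htE x.2)) (hδ0 x)
  choose G hGo hGs hGw using hG
  refine ⟨⋃ x, G x, isOpen_iUnion hGo, fun y hy => ?_, ?_⟩
  · obtain ⟨x, hx, hyx⟩ := mem_iUnion₂.1 (ht hy)
    exact mem_iUnion.2 ⟨⟨x, hx⟩, hGs ⟨x, hx⟩ ⟨hyx, hy⟩⟩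
  · exact (openWidth_iUnion_le _ _ _).trans
      ((ENNReal.tsum_le_tsum fun x => (hGw x).le).trans hδ.le)

/-! ### Curves with all chords in the cone, parametrized by their level -/

/-- The curves `γ` all of whose chords lie in the cone `C_{e,α}` (for `‖e‖ = 1`), parametrized so
that `⟨γ t, e⟩ - t` is constant. -/
def IsLevelCurve (e : 𝔼 n) (α : ℝ) (γ : ℝ → 𝔼 n) : Prop :=
  ∀ s t, s ≤ t → inner ℝ (γ t - γ s) e = t - s ∧ α * ‖γ t - γ s‖ ≤ t - s

theorem IsLevelCurve.lipschitzWith {e : 𝔼 n} {α : ℝ} {γ : ℝ → 𝔼 n} (hγ : IsLevelCurve e α γ)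
    (hα : 0 < α) : LipschitzWith (Real.toNNReal α⁻¹) γ := by
  refine LipschitzWith.of_dist_le' (K := α⁻¹) fun s t => ?_
  have key : ∀ s t, s ≤ t → ‖γ t - γ s‖ ≤ α⁻¹ * (t - s) := fun s t hst => by
    rw [← div_eq_inv_mul, le_div_iff₀ hα, mul_comm]
    exact (hγ s t hst).2
  rcases le_total s t with h | h
  · rw [dist_comm, dist_eq_norm, dist_comm, Real.dist_eq, abs_of_nonneg (sub_nonneg.2 h)]
    exact key s t h
  · rw [dist_eq_norm, Real.dist_eq, abs_of_nonneg (sub_nonneg.2 h)]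
    exact key t s h

theorem IsLevelCurve.mem_coneCurves {e : 𝔼 n} {α : ℝ} {γ : ℝ → 𝔼 n} (hγ : IsLevelCurve e α γ)
    (he : ‖e‖ = 1) (hα : 0 < α) : γ ∈ coneCurves e α := by
  have hL := hγ.lipschitzWith hα
  refine ⟨⟨_, hL⟩, ?_⟩
  filter_upwards [hL.ae_differentiableAt_real] with t ht
  refine ⟨deriv γ t, ?_, ht.hasDerivAt⟩
  have hs := ht.hasDerivAt.tendsto_slope_zero_right
  have h1 : Tendsto (fun h : ℝ => α * ‖h⁻¹ • (γ (t + h) - γ t)‖ * ‖e‖) (𝓝[>] 0)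
      (𝓝 (α * ‖deriv γ t‖ * ‖e‖)) := (hs.norm.const_mul α).mul_const _
  have h2 : Tendsto (fun h : ℝ => inner ℝ (h⁻¹ • (γ (t + h) - γ t)) e) (𝓝[>] 0)
      (𝓝 (inner ℝ (deriv γ t) e)) := hs.inner tendsto_const_nhds
  refine le_of_tendsto_of_tendsto h1 h2 ?_
  filter_upwards [self_mem_nhdsWithin] with h hh
  have hh : 0 < h := hh
  obtain ⟨h3, h4⟩ := hγ t (t + h) (by linarith)
  rw [he, mul_one, real_inner_smul_left, norm_smul, h3, norm_inv, Real.norm_of_nonneg hh.le,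
    mul_left_comm]
  gcongr

/-- The projection to the line along `e` is `1`-Lipschitz and inverts the level parametrization, so
it does not increase `ℋ¹`. Time spent in `G` can therefore replace length. -/
theorem IsLevelCurve.volume_preimage_le {e : 𝔼 n} {α : ℝ} {γ : ℝ → 𝔼 n}
    (hγ : IsLevelCurve e α γ) (he : ‖e‖ = 1) (hα : 0 < α) (G : Set (𝔼 n)) :
    volume (γ ⁻¹' G) ≤ openWidth e α G := by
  let p : (𝔼 n) → ℝ := fun z => inner ℝ (z - γ 0) e
  have hp : LipschitzWith 1 p := by
    refine LipschitzWith.of_dist_le_mul fun x y => ?_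
    rw [Real.dist_eq, dist_eq_norm, NNReal.coe_one, one_mul, ← inner_sub_left]
    refine (abs_real_inner_le_norm _ _).trans ?_
    simp [he]
  have hpγ : ∀ t, p (γ t) = t := by
    intro t
    rcases le_total 0 t with h | h
    · simpa using (hγ 0 t h).1
    · have := (hγ t 0 h).1
      simp only [p]
      rw [← neg_sub, inner_neg_left, this]; simp
  have hsub : γ ⁻¹' G ⊆ p '' (G ∩ range γ) := fun t ht =>
    ⟨γ t, ⟨ht, mem_range_self t⟩, hpγ t⟩
  calc volume (γ ⁻¹' G) ≤ Measure.hausdorffMeasure 1 (p '' (G ∩ range γ)) := by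
        rw [hausdorffMeasure_real]; exact measure_mono hsub
    _ ≤ Measure.hausdorffMeasure 1 (G ∩ range γ) := by
        simpa using (hp.lipschitzOnWith (s := G ∩ range γ)).hausdorffMeasure_image_le
          (zero_le_one (α := ℝ))
    _ ≤ openWidth e α G :=
        le_iSup₂ (f := fun γ (_ : γ ∈ coneCurves e α) =>
          Measure.hausdorffMeasure 1 (G ∩ range γ)) γ (hγ.mem_coneCurves he hα)

theorem isLevelCurve_line {e : 𝔼 n} {α : ℝ} (he : ‖e‖ = 1) (hα : α ≤ 1) (x : 𝔼 n) :
    IsLevelCurve e α fun t => x + t • e := by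
  intro s t hst
  have h : x + t • e - (x + s • e) = (t - s) • e := by rw [sub_smul]; abel
  simp only [h, real_inner_smul_left, real_inner_self_eq_norm_sq, norm_smul, he,
    Real.norm_of_nonneg (sub_nonneg.2 hst)]
  refine ⟨by ring, ?_⟩
  nlinarith

/-- Cutting a curve at `b` and continuing along a ray of the cone is the only modification of curves
needed; the speed `1 / ⟨v, e⟩` preserves the level parametrization. -/
theorem IsLevelCurve.exists_extend {e : 𝔼 n} {α : ℝ} {γ : ℝ → 𝔼 n} (hγ : IsLevelCurve e α γ)
    (b : ℝ) {v : 𝔼 n} (hv : α * ‖v‖ ≤ inner ℝ v e) (hpos : 0 < inner ℝ v e) (hα : 0 < α) :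
    ∃ γ', IsLevelCurve e α γ' ∧ (∀ t ≤ b, γ' t = γ t) ∧
      ∀ t, b ≤ t → γ' t = γ b + ((t - b) / inner ℝ v e) • v := by
  set c := inner ℝ v e with hc
  let γ' : ℝ → 𝔼 n := fun t => if t ≤ b then γ t else γ b + ((t - b) / c) • v
  have h1 : ∀ t ≤ b, γ' t = γ t := fun t ht => if_pos ht
  have h2 : ∀ t, b ≤ t → γ' t = γ b + ((t - b) / c) • v := by
    intro t ht
    rcases ht.eq_or_lt with rfl | ht
    · simp [γ']
    · exact if_neg ht.not_ge
  have h3 : ∀ s t, b ≤ s → s ≤ t →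
      inner ℝ (γ' t - γ' s) e = t - s ∧ α * ‖γ' t - γ' s‖ ≤ t - s := by
    intro s t hs hst
    have : γ' t - γ' s = ((t - s) / c) • v := by
      rw [h2 t (hs.trans hst), h2 s hs, add_sub_add_left_eq_sub, ← sub_smul]
      congr 1; ring
    have h0 : 0 ≤ (t - s) / c := div_nonneg (sub_nonneg.2 hst) hpos.le
    rw [this, real_inner_smul_left, norm_smul, Real.norm_of_nonneg h0, ← hc]
    refine ⟨div_mul_cancel₀ _ hpos.ne', ?_⟩
    calc α * ((t - s) / c * ‖v‖) = (t - s) / c * (α * ‖v‖) := by ring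
      _ ≤ (t - s) / c * c := by gcongr
      _ = t - s := div_mul_cancel₀ _ hpos.ne'
  refine ⟨γ', fun s t hst => ?_, h1, h2⟩
  rcases le_total t b with ht | ht
  · rw [h1 t ht, h1 s (hst.trans ht)]; exact hγ s t hst
  rcases le_total b s with hs | hs
  · exact h3 s t hs hst
  obtain ⟨h4, h5⟩ := h3 b t le_rfl ht
  obtain ⟨h6, h7⟩ := hγ s b hs
  rw [← h1 s hs, ← h1 b le_rfl] at h6 h7
  have h8 : γ' t - γ' s = (γ' t - γ' b) + (γ' b - γ' s) := by abel
  rw [h8, inner_add_left, h4, h6]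
  refine ⟨by ring, ?_⟩
  have := mul_le_mul_of_nonneg_left (norm_add_le (γ' t - γ' b) (γ' b - γ' s)) hα.le
  linarith

/-! ### The potential of an open set of small width -/

/-- The gains `|{t ≤ b : γ t ∈ G}| - s` of level curves with `γ b = x + s • e`, `s ≥ 0`. -/
def gains (e : 𝔼 n) (α : ℝ) (G : Set (𝔼 n)) (x : 𝔼 n) : Set ℝ :=
  {m | ∃ γ b s, IsLevelCurve e α γ ∧ 0 ≤ s ∧ γ b = x + s • e ∧
    m = volume.real (Iic b ∩ γ ⁻¹' G) - s}

/-- The potential of `G`: its slope along `e` is `1` in `G`, and between `0` and `1` elsewhere. -/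
noncomputable def potential (e : 𝔼 n) (α : ℝ) (G : Set (𝔼 n)) (x : 𝔼 n) : ℝ :=
  sSup (gains e α G x)

section

variable {e : 𝔼 n} {α η : ℝ} {G : Set (𝔼 n)}

theorem gains_nonempty (he : ‖e‖ = 1) (hα : α ≤ 1) (x : 𝔼 n) :
    ∃ m ∈ gains e α G x, 0 ≤ m :=
  ⟨_, ⟨_, 0, 0, isLevelCurve_line he hα x, le_rfl, by simp, rfl⟩, by simp⟩

theorem IsLevelCurve.volume_preimage_lt_top {γ : ℝ → 𝔼 n} (hγ : IsLevelCurve e α γ) (he : ‖e‖ = 1)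
    (hα : 0 < α) (hG : openWidth e α G ≤ ENNReal.ofReal η) : volume (γ ⁻¹' G) < ∞ :=
  ((hγ.volume_preimage_le he hα G).trans hG).trans_lt ENNReal.ofReal_lt_top

theorem le_of_mem_gains (he : ‖e‖ = 1) (hα : 0 < α) (hη : 0 ≤ η)
    (hG : openWidth e α G ≤ ENNReal.ofReal η) {x : 𝔼 n} {m : ℝ} (hm : m ∈ gains e α G x) :
    m ≤ η := by
  obtain ⟨γ, b, s, hγ, hs, -, rfl⟩ := hm
  have h : volume (Iic b ∩ γ ⁻¹' G) ≤ ENNReal.ofReal η :=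
    (measure_mono inter_subset_right).trans ((hγ.volume_preimage_le he hα G).trans hG)
  have := ENNReal.toReal_le_of_le_ofReal hη h
  rw [Measure.real]; linarith

theorem bddAbove_gains (he : ‖e‖ = 1) (hα : 0 < α) (hη : 0 ≤ η)
    (hG : openWidth e α G ≤ ENNReal.ofReal η) (x : 𝔼 n) : BddAbove (gains e α G x) :=
  ⟨η, fun _ hm => le_of_mem_gains he hα hη hG hm⟩

theorem potential_nonneg (he : ‖e‖ = 1) (hα : 0 < α) (hα1 : α ≤ 1) (hη : 0 ≤ η)
    (hG : openWidth e α G ≤ ENNReal.ofReal η) (x : 𝔼 n) : 0 ≤ potential e α G x := by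
  obtain ⟨m, hm, h0⟩ := gains_nonempty (G := G) he hα1 x
  exact h0.trans (le_csSup (bddAbove_gains he hα hη hG x) hm)

theorem potential_le (he : ‖e‖ = 1) (hα : 0 < α) (hα1 : α ≤ 1) (hη : 0 ≤ η)
    (hG : openWidth e α G ≤ ENNReal.ofReal η) (x : 𝔼 n) : potential e α G x ≤ η := by
  obtain ⟨m, hm, -⟩ := gains_nonempty (G := G) he hα1 x
  exact csSup_le ⟨m, hm⟩ fun m hm => le_of_mem_gains he hα hη hG hm

theorem potential_add_le (he : ‖e‖ = 1) (hα : 0 < α) (hα1 : α ≤ 1) (hη : 0 ≤ η)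
    (hG : openWidth e α G ≤ ENNReal.ofReal η) {x y : 𝔼 n} {c : ℝ}
    (h : ∀ m ∈ gains e α G x, ∃ m' ∈ gains e α G y, m + c ≤ m') :
    potential e α G x + c ≤ potential e α G y := by
  obtain ⟨m, hm, -⟩ := gains_nonempty (G := G) he hα1 x
  rw [← le_sub_iff_add_le]
  refine csSup_le ⟨m, hm⟩ fun m hm => ?_
  obtain ⟨m', hm', hle⟩ := h m hm
  have := le_csSup (bddAbove_gains he hα hη hG y) hm'
  rw [potential]; linarith

/-- A curve ending at `x + s • e` is continued by the segment `v` to `x + v + s • e`; the penalty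
`s` is unchanged and no time in `G` is lost. -/
theorem potential_le_add_cone (he : ‖e‖ = 1) (hα : 0 < α) (hα1 : α ≤ 1) (hη : 0 ≤ η)
    (hG : openWidth e α G ≤ ENNReal.ofReal η) (x : 𝔼 n) {v : 𝔼 n}
    (hv : α * ‖v‖ ≤ inner ℝ v e) : potential e α G x ≤ potential e α G (x + v) := by
  rcases eq_or_ne v 0 with rfl | hv0
  · simp
  have hpos : 0 < inner ℝ v e := (mul_pos hα (norm_pos_iff.2 hv0)).trans_le hv
  rw [← add_zero (potential e α G x)]
  refine potential_add_le he hα hα1 hη hG ?_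
  rintro _ ⟨γ, b, s, hγ, hs, hb, rfl⟩
  obtain ⟨γ', hγ', h1, h2⟩ := hγ.exists_extend b hv hpos hα
  refine ⟨_, ⟨γ', b + inner ℝ v e, s, hγ', hs, ?_, rfl⟩, ?_⟩
  · rw [h2 _ (by linarith), add_sub_cancel_left, div_self hpos.ne', one_smul, hb]; abel
  · have hsub : Iic b ∩ γ ⁻¹' G ⊆ Iic (b + inner ℝ v e) ∩ γ' ⁻¹' G := by
      rintro t ⟨ht, htG⟩
      have ht : t ≤ b := ht
      exact ⟨ht.trans (by linarith), by rw [mem_preimage, h1 t ht]; exact htG⟩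
    have := measureReal_mono (μ := volume) hsub ((measure_mono inter_subset_right).trans_lt
      (hγ'.volume_preimage_lt_top he hα hG)).ne
    linarith

/-- This is what the penalty is for: a curve competing at `x + t • e` also competes at `x`, with `s`
replaced by `t + s`. -/
theorem potential_add_smul_le (he : ‖e‖ = 1) (hα : 0 < α) (hα1 : α ≤ 1) (hη : 0 ≤ η)
    (hG : openWidth e α G ≤ ENNReal.ofReal η) (x : 𝔼 n) {t : ℝ} (ht : 0 ≤ t) :
    potential e α G (x + t • e) ≤ potential e α G x + t := by
  have := potential_add_le he hα hα1 hη hG (x := x + t • e) (y := x) (c := -t) ?_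
  · linarith
  rintro _ ⟨γ, b, s, hγ, hs, hb, rfl⟩
  exact ⟨_, ⟨γ, b, t + s, hγ, by linarith, by rw [hb, add_smul, add_assoc], rfl⟩, by linarith⟩

/-- If `s ≥ t`, the same curve has its penalty lowered by `t`. Otherwise the penalty `s` disappears
and the remaining segment of length `t - s` is run inside `G`; the total improvement is again `t`.
-/
theorem add_le_potential_add_smul (he : ‖e‖ = 1) (hα : 0 < α) (hα1 : α ≤ 1) (hη : 0 ≤ η)
    (hG : openWidth e α G ≤ ENNReal.ofReal η) (x : 𝔼 n) {t : ℝ}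
    (hseg : ∀ s, 0 ≤ s → s ≤ t → x + s • e ∈ G) :
    potential e α G x + t ≤ potential e α G (x + t • e) := by
  refine potential_add_le he hα hα1 hη hG ?_
  rintro _ ⟨γ, b, s, hγ, hs, hb, rfl⟩
  rcases le_or_gt t s with hst | hst
  · exact ⟨_, ⟨γ, b, s - t, hγ, by linarith, by rw [hb, sub_smul]; abel, rfl⟩, by linarith⟩
  have hee : inner ℝ e e = (1 : ℝ) := by rw [real_inner_self_eq_norm_sq, he, one_pow]
  obtain ⟨γ', hγ', h1, h2⟩ := hγ.exists_extend b (v := e) (by rw [he, hee]; linarith)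
    (by rw [hee]; exact one_pos) hα
  refine ⟨_, ⟨γ', b + (t - s), 0, hγ', le_rfl, ?_, rfl⟩, ?_⟩
  · rw [h2 _ (by linarith), hee, hb, zero_smul, add_zero, add_assoc, ← add_smul]
    congr 2; ring
  have hdisj : Disjoint (Iic b ∩ γ ⁻¹' G) (Ioc b (b + (t - s))) :=
    disjoint_left.2 fun u hu hu' => (not_lt.2 (show u ≤ b from hu.1)) hu'.1
  have hsub : Iic b ∩ γ ⁻¹' G ∪ Ioc b (b + (t - s)) ⊆ Iic (b + (t - s)) ∩ γ' ⁻¹' G := by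
    rintro u (⟨hu, huG⟩ | ⟨hu, hu'⟩)
    · have hu : u ≤ b := hu
      exact ⟨show u ≤ _ by linarith, by rw [mem_preimage, h1 u hu]; exact huG⟩
    · refine ⟨hu', ?_⟩
      rw [mem_preimage, h2 u hu.le, hee, hb, add_assoc, ← add_smul]
      exact hseg _ (by rw [div_one]; linarith) (by rw [div_one]; linarith)
  have hlt : volume (Iic b ∩ γ ⁻¹' G) ≠ ∞ := ((measure_mono inter_subset_right).trans_lt
      (hγ.volume_preimage_lt_top he hα hG)).ne
  have h3 := measureReal_mono (μ := volume) hsub ((measure_mono inter_subset_right).trans_lt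
      (hγ'.volume_preimage_lt_top he hα hG)).ne
  rw [measureReal_union hdisj measurableSet_Ioc hlt (by simp), Real.volume_real_Ioc_of_le
    (by linarith)] at h3
  linarith

/-- A function that is small on the whole space and nearly linear with slope `e` in the open set
`G ⊇ E`, and whose increments are controlled by those of the positive part. -/
theorem UniformlyPurelyUnrectifiable.exists_potential {E : Set (𝔼 n)}
    (hE : UniformlyPurelyUnrectifiable E) (he : ‖e‖ = 1) {ε : ℝ} (hε : 0 < ε) (hε1 : ε ≤ 1)
    (hη : 0 < η) :
    ∃ ω : (𝔼 n) → ℝ, (∀ x, 0 ≤ ω x) ∧ (∀ x, ω x ≤ η) ∧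
      (∀ x y, ω y - ω x ≤ max (inner ℝ (y - x) e) 0 + ε * ‖y - x‖) ∧
      ∀ x ∈ E, ∃ r > 0, ∀ y ∈ Metric.ball x r, ∀ z ∈ Metric.ball x r,
        inner ℝ (y - z) e - ε * ‖y - z‖ ≤ ω y - ω z := by
  -- In both estimates below the correction vector has norm at most `3 * ‖v‖`, so the slack `ε *
  -- ‖v‖` puts it into the cone of aperture `ε / 3`.
  have hα : 0 < ε / 3 := by positivity
  have hα1 : ε / 3 ≤ 1 := by linarith
  have he0 : e ≠ 0 := by rintro rfl; simp at he
  have hee : inner ℝ e e = (1 : ℝ) := by rw [real_inner_self_eq_norm_sq, he, one_pow]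
  obtain ⟨G, hGo, hEG, hG⟩ := hE.exists_open_openWidth_le he0 hα hα1 hη
  refine ⟨potential e (ε / 3) G, potential_nonneg he hα hα1 hη.le hG,
    potential_le he hα hα1 hη.le hG, fun x y => ?_, fun x hx => ?_⟩
  · set v := y - x with hv
    have hvn := norm_nonneg v
    have hin : |inner ℝ v e| ≤ ‖v‖ := by simpa [he] using abs_real_inner_le_norm v e
    obtain ⟨hin1, hin2⟩ := abs_le.1 hin
    set t := max (inner ℝ v e) 0 + ε * ‖v‖ with ht
    have hm0 : 0 ≤ max (inner ℝ v e) 0 := le_max_right _ _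
    have hm1 : inner ℝ v e ≤ max (inner ℝ v e) 0 := le_max_left _ _
    have hm2 : max (inner ℝ v e) 0 ≤ ‖v‖ := max_le hin2 hvn
    have hεv : ε * ‖v‖ ≤ ‖v‖ := by nlinarith
    have hεv0 : 0 ≤ ε * ‖v‖ := by positivity
    have ht0 : 0 ≤ t := by positivity
    have hcone : ε / 3 * ‖t • e - v‖ ≤ inner ℝ (t • e - v) e := by
      have h1 : ‖t • e - v‖ ≤ t + ‖v‖ := by
        simpa [norm_smul, he, abs_of_nonneg ht0] using norm_sub_le (t • e) v
      rw [inner_sub_left, real_inner_smul_left, hee]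
      have h2 : ε / 3 * ‖t • e - v‖ ≤ ε / 3 * (3 * ‖v‖) := by
        gcongr; linarith
      linarith
    have h1 := potential_le_add_cone he hα hα1 hη.le hG y hcone
    have h2 : y + (t • e - v) = x + t • e := by rw [hv]; abel
    rw [h2] at h1
    linarith [potential_add_smul_le he hα hα1 hη.le hG x ht0]
  · obtain ⟨r, hr, hrG⟩ := Metric.isOpen_iff.1 hGo x (hEG hx)
    -- For `y`, `z` in this ball, a segment from `z` of length at most `‖y - z‖ < 2 * r / 3` stays
    -- in the ball of radius `r`, hence in `G`.
    refine ⟨r / 3, by positivity, fun y hy z hz => ?_⟩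
    rw [Metric.mem_ball, dist_eq_norm] at hy hz
    set v := y - z with hv
    have hvn := norm_nonneg v
    have hvr : ‖v‖ < 2 * r / 3 := by
      have h1 : v = (y - x) - (z - x) := by rw [hv]; abel
      have := norm_sub_le (y - x) (z - x)
      rw [h1]; linarith
    have hin : |inner ℝ v e| ≤ ‖v‖ := by simpa [he] using abs_real_inner_le_norm v e
    obtain ⟨hin1, hin2⟩ := abs_le.1 hin
    set t := inner ℝ v e - ε * ‖v‖ with ht
    have hεv : ε * ‖v‖ ≤ ‖v‖ := by nlinarith
    have hεv0 : 0 ≤ ε * ‖v‖ := by positivity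
    have hcone : ε / 3 * ‖v - t • e‖ ≤ inner ℝ (v - t • e) e := by
      have h1 : ‖v - t • e‖ ≤ ‖v‖ + |t| := by
        simpa [norm_smul, he] using norm_sub_le v (t • e)
      have h3 : |t| ≤ 2 * ‖v‖ := abs_le.2 ⟨by linarith, by linarith⟩
      rw [inner_sub_left, real_inner_smul_left, hee]
      have h2 : ε / 3 * ‖v - t • e‖ ≤ ε / 3 * (3 * ‖v‖) := by
        gcongr; linarith
      linarith
    have h1 := potential_le_add_cone he hα hα1 hη.le hG (z + t • e) hcone
    have h2 : z + t • e + (v - t • e) = y := by rw [hv]; abel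
    rw [h2] at h1
    suffices potential e (ε / 3) G z + t ≤ potential e (ε / 3) G (z + t • e) by linarith
    rcases le_total 0 t with ht0 | ht0
    · refine add_le_potential_add_smul he hα hα1 hη.le hG z fun s hs hst => hrG ?_
      rw [Metric.mem_ball, dist_eq_norm]
      have h3 : z + s • e - x = (z - x) + s • e := by abel
      have h4 := norm_add_le (z - x) (s • e)
      rw [norm_smul, he, mul_one, Real.norm_of_nonneg hs] at h4
      rw [h3]; linarith
    · have h3 := potential_add_smul_le he hα hα1 hη.le hG (z + t • e) (neg_nonneg.2 ht0)
      rw [neg_smul, add_neg_cancel_right] at h3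
      linarith

/-! ### Localizing the size of the potential -/

/-- The function `ω` has the increments of a function of slope in `[0,1]·e`, up to an error `ε`. -/
def HasSlopeUpTo (e : 𝔼 n) (ε : ℝ) (ω : (𝔼 n) → ℝ) : Prop :=
  ∀ x y, ω y - ω x ≤ max (inner ℝ (y - x) e) 0 + ε * ‖y - x‖

/-- Near `x`, the function `f - ⟨e, ·⟩` is `ε`-Lipschitz. -/
def NearlyAffineAt (e : 𝔼 n) (ε : ℝ) (f : (𝔼 n) → ℝ) (x : 𝔼 n) : Prop :=
  ∃ r > 0, ∀ y ∈ Metric.ball x r, ∀ z ∈ Metric.ball x r,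
    |f y - f z - inner ℝ (y - z) e| ≤ ε * ‖y - z‖

theorem isOpen_nearlyAffineAt (e : 𝔼 n) (ε : ℝ) (f : (𝔼 n) → ℝ) :
    IsOpen {x | NearlyAffineAt e ε f x} := by
  refine Metric.isOpen_iff.2 fun x ⟨r, hr, h⟩ => ⟨r, hr, fun y hy => ?_⟩
  obtain ⟨δ, hδ, hsub⟩ := Metric.isOpen_iff.1 Metric.isOpen_ball y hy
  exact ⟨δ, hδ, fun z hz w hw => h z (hsub hz) w (hsub hw)⟩

theorem nearlyAffineAt_of_le {ε : ℝ} {f : (𝔼 n) → ℝ} {x : 𝔼 n}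
    (h : ∃ r > 0, ∀ y ∈ Metric.ball x r, ∀ z ∈ Metric.ball x r,
        inner ℝ (y - z) e - ε * ‖y - z‖ ≤ f y - f z) : NearlyAffineAt e ε f x := by
  obtain ⟨r, hr, h⟩ := h
  refine ⟨r, hr, fun y hy z hz => abs_le.2 ⟨by linarith [h y hy z hz], ?_⟩⟩
  have := h z hz y hy
  rw [← neg_sub y z, inner_neg_left, norm_neg] at this
  linarith

theorem exists_pos_forall_mem_le {ι : Type*} (s : Finset ι) {r : ι → ℝ} (hr : ∀ i, 0 < r i) :
    ∃ ρ > 0, ∀ i ∈ s, ρ ≤ r i := by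
  rcases s.eq_empty_or_nonempty with rfl | hs
  · exact ⟨1, one_pos, by simp⟩
  · exact ⟨s.inf' hs r, (Finset.lt_inf'_iff hs).2 fun i _ => hr i, fun i hi => s.inf'_le r hi⟩

/-- Localization of `exists_potential`: the bound is a multiple of a prescribed `1`-Lipschitz
function that is positive on `E`. -/
theorem UniformlyPurelyUnrectifiable.exists_potential_le {E : Set (𝔼 n)}
    (hE : UniformlyPurelyUnrectifiable E) (he : ‖e‖ = 1) {ε : ℝ} (hε : 0 < ε) (hε1 : ε ≤ 1)
    {τ : (𝔼 n) → ℝ} (hτ : LipschitzWith 1 τ) (hτ0 : ∀ x, 0 ≤ τ x) (hτ1 : ∀ x, τ x ≤ 1)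
    (hτE : ∀ x ∈ E, 0 < τ x) :
    ∃ ω : (𝔼 n) → ℝ, (∀ x, 0 ≤ ω x) ∧ (∀ x, ω x ≤ ε * τ x) ∧ HasSlopeUpTo e ε ω ∧
      ∀ x ∈ E, NearlyAffineAt e ε ω x := by
  have hδ : 0 < ε / 2 := by positivity
  set δ := ε / 2 with hδε
  let a : ℕ → ℝ := fun m => (2 / 3) ^ m
  have ha0 : ∀ m, 0 < a m := fun m => by positivity
  have ha : Tendsto a atTop (𝓝 0) := tendsto_pow_atTop_nhds_zero_of_lt_one (by norm_num)
    (by norm_num)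
  have hτL : ∀ x y, |τ y - τ x| ≤ ‖y - x‖ := fun x y => by
    simpa [Real.dist_eq, dist_eq_norm] using hτ.dist_le_mul y x
  choose u hu0 hu1 hu2 hu3 using fun m : ℕ => hE.exists_potential he hδ (by linarith)
    (η := δ * a m / 6) (by have := ha0 m; positivity)
  -- `F m` is useful where `τ` is comparable to `a m`; the penalty removes it elsewhere. If `2 / 3 *
  -- a m < τ x ≤ a m`, then `F m x ≤ δ * τ x / 4 + δ * τ x / 2`, whereas `a m < τ x / 4` forces `F m
  -- x > 3 / 4 * (δ * τ x)`. So near a point of `E` only finitely many `m` matter in the infimum.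
  -- The potential and the penalty each contribute `δ = ε / 2` to the error.
  let F : ℕ → (𝔼 n) → ℝ := fun m x => u m x + δ * |τ x - a m|
  have hF0 : ∀ m x, 0 ≤ F m x := fun m x => by have := hu0 m x; positivity
  have hbdd : ∀ x, BddBelow (range fun m => F m x) := fun x => ⟨0, by
    rintro _ ⟨m, rfl⟩; exact hF0 m x⟩
  have hpen : ∀ m x y, |δ * (|τ y - a m|) - δ * (|τ x - a m|)| ≤ δ * ‖y - x‖ := fun m x y => by
    rw [← mul_sub, abs_mul, abs_of_pos hδ]
    gcongr
    refine (abs_abs_sub_abs_le_abs_sub _ _).trans ?_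
    rw [sub_sub_sub_cancel_right]; exact hτL x y
  have hnear : ∀ x, 0 < τ x → ∃ m, τ x / 4 < a m ∧ F m x ≤ 3 / 4 * (δ * τ x) := by
    intro x hx
    obtain ⟨m, h1, h2⟩ := exists_nat_pow_near_of_lt_one hx (hτ1 x)
      (by norm_num : (0 : ℝ) < 2 / 3) (by norm_num)
    have h2 : τ x ≤ a m := h2
    have h1 : 2 / 3 * a m < τ x := by simpa [a, pow_succ, mul_comm] using h1
    refine ⟨m, by linarith, ?_⟩
    have h3 : F m x = u m x + δ * (a m - τ x) := by
      simp only [F]; rw [abs_of_nonpos (by linarith), neg_sub]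
    rw [h3]
    have h4 := hu1 m x
    nlinarith
  refine ⟨fun x => ⨅ m, F m x, fun x => le_ciInf fun m => hF0 m x, fun x => ?_, fun x y => ?_,
    fun x hx => ?_⟩
  · rcases (hτ0 x).eq_or_lt with h0 | h0
    · have hlim : Tendsto (fun m => δ * a m / 6 + δ * a m) atTop (𝓝 (δ * 0 / 6 + δ * 0)) :=
        ((ha.const_mul δ).div_const 6).add (ha.const_mul δ)
      simp only [mul_zero, zero_div, add_zero] at hlim
      rw [← h0, mul_zero]
      refine ge_of_tendsto' hlim fun m => (ciInf_le (hbdd x) m).trans ?_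
      simp only [F]
      rw [← h0, zero_sub, abs_neg, abs_of_pos (ha0 m)]
      gcongr; exact hu1 m x
    · obtain ⟨m, -, hm⟩ := hnear x h0
      refine (ciInf_le (hbdd x) m).trans (hm.trans ?_)
      nlinarith
  · rw [sub_le_iff_le_add', ← sub_le_iff_le_add]
    refine le_ciInf fun m => ?_
    rw [sub_le_iff_le_add]
    refine (ciInf_le (hbdd y) m).trans ?_
    have h1 := hu2 m x y
    have h2 := (abs_le.1 (hpen m x y)).2
    simp only [F]
    rw [hδε] at h1 h2 ⊢
    linarith
  · have hx0 := hτE x hx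
    obtain ⟨N, hN⟩ := (ha.eventually (gt_mem_nhds (show 0 < τ x / 8 by positivity))).exists
    have hN : ∀ m, N ≤ m → a m < τ x / 8 := fun m hm =>
      (pow_le_pow_of_le_one (by norm_num) (by norm_num) hm).trans_lt hN
    choose r hr0 hr using fun m : ℕ => hu3 m x hx
    obtain ⟨ρ, hρ0, hρ⟩ : ∃ ρ > 0, ∀ m < N, ρ ≤ r m := by
      simpa using exists_pos_forall_mem_le (Finset.range N) hr0
    refine nearlyAffineAt_of_le ⟨min ρ (τ x / 2), lt_min hρ0 (by positivity),
      fun y hy z hz => ?_⟩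
    have hτy : τ x / 2 < τ y := by
      have h1 := (abs_le.1 (hτL x y)).1
      have h2 : ‖y - x‖ < τ x / 2 := by
        rw [← dist_eq_norm]; exact (Metric.mem_ball.1 hy).trans_le (min_le_right _ _)
      linarith
    have hlt : ∀ m, τ y / 4 < a m → m < N := fun m hm => by
      by_contra hmN
      linarith [hN m (not_lt.1 hmN)]
    have hsmall : ∀ m < N, (⨅ k, F k z) ≤ F m y - inner ℝ (y - z) e + ε * ‖y - z‖ := by
      intro m hm
      have hsub : Metric.ball x (min ρ (τ x / 2)) ⊆ Metric.ball x (r m) :=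
        Metric.ball_subset_ball ((min_le_left _ _).trans (hρ m hm))
      have h1 := hr m y (hsub hy) z (hsub hz)
      have h2 := (abs_le.1 (hpen m z y)).1
      refine (ciInf_le (hbdd z) m).trans ?_
      simp only [F]
      rw [hδε] at h1 h2 ⊢
      linarith
    have : (⨅ k, F k z) + inner ℝ (y - z) e - ε * ‖y - z‖ ≤ ⨅ k, F k y := by
      refine le_ciInf fun m => ?_
      rcases lt_or_ge m N with hm | hm
      · linarith [hsmall m hm]
      · obtain ⟨k, hk, hFk⟩ := hnear y (by linarith)
        have h1 := hsmall k (hlt k hk)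
        have h2 : 3 / 4 * (δ * τ y) ≤ F m y := by
          have h3 := le_abs_self (τ y - a m)
          have h4 := hN m hm
          have h5 := hu0 m y
          simp only [F]
          nlinarith
        linarith
    linarith

theorem UniformlyPurelyUnrectifiable.exists_potential_le_of_norm_le_one {E : Set (𝔼 n)}
    (hE : UniformlyPurelyUnrectifiable E) (he : ‖e‖ ≤ 1) {ε : ℝ} (hε : 0 < ε) (hε1 : ε ≤ 1)
    {τ : (𝔼 n) → ℝ} (hτ : LipschitzWith 1 τ) (hτ0 : ∀ x, 0 ≤ τ x) (hτ1 : ∀ x, τ x ≤ 1)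
    (hτE : ∀ x ∈ E, 0 < τ x) :
    ∃ ω : (𝔼 n) → ℝ, (∀ x, 0 ≤ ω x) ∧ (∀ x, ω x ≤ ε * τ x) ∧ HasSlopeUpTo e ε ω ∧
      ∀ x ∈ E, NearlyAffineAt e ε ω x := by
  rcases eq_or_ne e 0 with rfl | he0
  · refine ⟨0, fun x => le_rfl, fun x => mul_nonneg hε.le (hτ0 x), fun x y => ?_,
      fun x _ => ⟨1, one_pos, fun y _ z _ => ?_⟩⟩ <;> simp <;> positivity
  have hpos : 0 < ‖e‖ := norm_pos_iff.2 he0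
  obtain ⟨ω, h0, h1, h2, h3⟩ := hE.exists_potential_le (e := ‖e‖⁻¹ • e)
    (norm_smul_inv_norm he0) hε hε1 hτ hτ0 hτ1 hτE
  have hin : ∀ v : 𝔼 n, inner ℝ v e = ‖e‖ * inner ℝ v (‖e‖⁻¹ • e) := fun v => by
    rw [real_inner_smul_right, mul_inv_cancel_left₀ hpos.ne']
  have hmul : ∀ c : ℝ, 0 ≤ c → ‖e‖ * c ≤ c := fun c hc => mul_le_of_le_one_left hc he
  refine ⟨fun x => ‖e‖ * ω x, fun x => mul_nonneg hpos.le (h0 x),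
    fun x => (hmul _ (h0 x)).trans (h1 x), fun x y => ?_, fun x hx => ?_⟩
  · rw [hin, ← mul_sub, ← mul_zero ‖e‖, ← mul_max_of_nonneg _ _ hpos.le]
    refine (mul_le_mul_of_nonneg_left (h2 x y) hpos.le).trans ?_
    rw [mul_add]
    exact add_le_add le_rfl (hmul _ (mul_nonneg hε.le (norm_nonneg _)))
  · obtain ⟨r, hr, h⟩ := h3 x hx
    refine ⟨r, hr, fun y hy z hz => ?_⟩
    rw [hin, ← mul_sub, ← mul_sub, abs_mul, abs_of_pos hpos]
    exact (mul_le_mul_of_nonneg_left (h y hy z hz) hpos.le).trans (hmul _ (by positivity))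

end

/-! ### Auxiliary facts on Lipschitz functions -/

/-- A mean value argument along the segment. The hypothesis compares only with the centre `x`, which
is all that is available at boundary points when functions are glued. -/
theorem abs_sub_le_of_forall_pointwise {f : (𝔼 n) → ℝ} {C : ℝ} {s : Set (𝔼 n)} (hs : Convex ℝ s)
    (h : ∀ x ∈ s, ∃ r > 0, ∀ y ∈ Metric.ball x r, |f y - f x| ≤ C * ‖y - x‖)
    {x y : 𝔼 n} (hx : x ∈ s) (hy : y ∈ s) : |f y - f x| ≤ C * ‖y - x‖ := by
  have key : ∀ {x y : 𝔼 n}, x ∈ s → y ∈ s → f y - f x ≤ C * ‖y - x‖ := by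
    intro x y hx hy
    let p : ℝ → 𝔼 n := fun t => x + t • (y - x)
    have hp : Continuous p := by fun_prop
    have hpd : ∀ t t', ‖p t' - p t‖ = |t' - t| * ‖y - x‖ := fun t t' => by
      have : p t' - p t = (t' - t) • (y - x) := by simp only [p, sub_smul]; abel
      rw [this, norm_smul, Real.norm_eq_abs]
    have hps : ∀ t ∈ Icc (0 : ℝ) 1, p t ∈ s := fun t ht => hs.add_smul_sub_mem hx hy ht
    have hloc : ∀ t ∈ Icc (0 : ℝ) 1,
        ∀ᶠ t' in 𝓝 t, |f (p t') - f (p t)| ≤ C * ‖y - x‖ * |t' - t| := by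
      intro t ht
      obtain ⟨r, hr, h⟩ := h (p t) (hps t ht)
      filter_upwards [hp.continuousAt (Metric.ball_mem_nhds (p t) hr)] with t' ht'
      refine (h _ ht').trans_eq ?_
      rw [hpd]; ring
    have hcont : ContinuousOn (fun t => f (p t)) (Icc 0 1) := by
      intro t ht
      refine ContinuousAt.continuousWithinAt ?_
      refine tendsto_iff_norm_sub_tendsto_zero.2 ?_
      have hlim : Tendsto (fun t' => C * ‖y - x‖ * |t' - t|) (𝓝 t) (𝓝 0) := by
        have : Continuous fun t' => C * ‖y - x‖ * |t' - t| := by fun_prop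
        simpa using this.tendsto t
      exact squeeze_zero' (Eventually.of_forall fun _ => norm_nonneg _) (hloc t ht) hlim
    have := image_le_of_liminf_slope_right_le_deriv_boundary hcont
      (B := fun t => f x + C * ‖y - x‖ * t) (B' := fun _ => C * ‖y - x‖) (by simp [p])
      (by fun_prop) (fun t _ => by
        simpa using (((hasDerivAt_id t).const_mul (C * ‖y - x‖)).const_add
          (f x)).hasDerivWithinAt) (fun t ht q hq => by
        refine Eventually.frequently ?_
        filter_upwards [nhdsWithin_le_nhds (hloc t (Ico_subset_Icc_self ht)),
          self_mem_nhdsWithin] with t' h1 h2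
        have h2 : 0 < t' - t := sub_pos.2 h2
        rw [slope_def_field, div_lt_iff₀ h2]
        rw [abs_of_pos h2] at h1
        have := (abs_le.1 h1).2
        have := mul_lt_mul_of_pos_right hq h2
        linarith) (right_mem_Icc.2 zero_le_one)
    simp only [p, one_smul, add_sub_cancel, mul_one] at this
    linarith
  refine abs_le.2 ⟨?_, key hx hy⟩
  have := key hy hx
  rw [norm_sub_rev] at this
  linarith

theorem NearlyAffineAt.of_ball {e : 𝔼 n} {ε : ℝ} {f : (𝔼 n) → ℝ} {x : 𝔼 n} {d : ℝ}
    (h : ∀ y ∈ Metric.ball x d, NearlyAffineAt e ε f y) {y z : 𝔼 n} (hy : y ∈ Metric.ball x d)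
    (hz : z ∈ Metric.ball x d) : |f y - f z - inner ℝ (y - z) e| ≤ ε * ‖y - z‖ := by
  have := abs_sub_le_of_forall_pointwise (f := fun y => f y - inner ℝ y e) (C := ε)
    (convex_ball x d) (fun w hw => ?_) hz hy
  · rw [inner_sub_left]
    convert this using 2
    ring
  obtain ⟨r, hr, h⟩ := h w hw
  refine ⟨r, hr, fun y hy => ?_⟩
  have := h y hy w (Metric.mem_ball_self hr)
  rw [inner_sub_left] at this
  convert this using 2
  ring

theorem exists_lipschitzWith_ball_subset {V : Set (𝔼 n)} (hV : IsOpen V) :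
    ∃ d : (𝔼 n) → ℝ, LipschitzWith 1 d ∧ (∀ x, 0 ≤ d x) ∧ (∀ x, d x ≤ 1) ∧
      (∀ x ∈ V, 0 < d x) ∧ (∀ x ∉ V, d x = 0) ∧ ∀ x, Metric.ball x (d x) ⊆ V := by
  -- `Metric.infDist` to the empty set is `0`, so the whole space needs its own choice of `d`.
  rcases eq_empty_or_nonempty Vᶜ with h | h
  · have : V = univ := by simpa using h
    subst this
    exact ⟨fun _ => 1, LipschitzWith.const' 1, by simp, by simp, by simp, by simp, by simp⟩
  · refine ⟨fun x => min 1 (Metric.infDist x Vᶜ), (Metric.lipschitz_infDist_pt _).const_min 1,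
      fun x => le_min zero_le_one Metric.infDist_nonneg, fun x => min_le_left _ _,
      fun x hx => lt_min one_pos ?_, fun x hx => ?_, fun x => ?_⟩
    · exact (hV.isClosed_compl.notMem_iff_infDist_pos h).1 (by simpa using hx)
    · simp [Metric.infDist_zero_of_mem (show x ∈ Vᶜ from hx)]
    · exact (Metric.ball_subset_ball (min_le_right _ _)).trans Metric.ball_infDist_compl_subset

theorem LipschitzWith.one_const_mul {f : (𝔼 n) → ℝ} (hf : LipschitzWith 1 f) {c : ℝ} (h0 : 0 ≤ c)
    (h1 : c ≤ 1) : LipschitzWith 1 fun x => c * f x := by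
  refine LipschitzWith.of_dist_le_mul fun x y => ?_
  rw [Real.dist_eq, ← mul_sub, abs_mul, abs_of_nonneg h0, ← Real.dist_eq]
  exact (mul_le_of_le_one_left dist_nonneg h1).trans (hf.dist_le_mul x y)

/-- The triangle inequality for the vectors with entries `|v i|` and `c`; the crude factor `n` is
harmless. -/
theorem norm_le_of_forall_abs_le {u v : 𝔼 n} {c : ℝ} (hc : 0 ≤ c)
    (h : ∀ i, |u i| ≤ |v i| + c) : ‖u‖ ≤ ‖v‖ + n * c := by
  let a : 𝔼 n := WithLp.toLp 2 fun i => |v i|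
  let b : 𝔼 n := WithLp.toLp 2 fun _ => c
  have ha : ‖a‖ = ‖v‖ := by simp [EuclideanSpace.norm_eq, a]
  have hb : ‖b‖ ≤ n * c := by
    have : b = ∑ i, EuclideanSpace.single i c := by
      ext j
      simp [b, Finset.sum_apply, Pi.single_apply]
    rw [this]
    refine (norm_sum_le _ _).trans ?_
    simp [abs_of_nonneg hc]
  have hu : ‖u‖ ≤ ‖a + b‖ := by
    rw [EuclideanSpace.norm_eq, EuclideanSpace.norm_eq]
    refine Real.sqrt_le_sqrt (Finset.sum_le_sum fun i _ => ?_)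
    have h1 : (a + b) i = |v i| + c := rfl
    rw [h1, Real.norm_eq_abs, Real.norm_eq_abs, abs_of_nonneg (by positivity : 0 ≤ |v i| + c)]
    gcongr
    exact h i
  linarith [norm_add_le a b]

/-! ### Flattening a function near `E` and changing its slope there -/

/-- A perturbation of the identity that nearly contracts small neighbourhoods of the points
of `E`. -/
theorem UniformlyPurelyUnrectifiable.exists_flattening {E : Set (𝔼 n)}
    (hE : UniformlyPurelyUnrectifiable E) {δ : ℝ} (hδ : 0 < δ) (hδ1 : δ ≤ 1)
    {τ : (𝔼 n) → ℝ} (hτ : LipschitzWith 1 τ) (hτ0 : ∀ x, 0 ≤ τ x) (hτ1 : ∀ x, τ x ≤ 1)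
    (hτE : ∀ x ∈ E, 0 < τ x) :
    ∃ Φ : (𝔼 n) → 𝔼 n, (∀ x, ‖Φ x - x‖ ≤ n * δ * τ x) ∧
      (∀ x y, ‖Φ y - Φ x‖ ≤ (1 + n * δ) * ‖y - x‖) ∧
      ∀ x ∈ E, ∃ r > 0, ∀ y ∈ Metric.ball x r, ∀ z ∈ Metric.ball x r,
        ‖Φ y - Φ z‖ ≤ n * δ * ‖y - z‖ := by
  choose ω h0 h1 h2 h3 using fun i : Fin n =>
    hE.exists_potential_le (e := EuclideanSpace.single i (1 : ℝ)) (by simp) hδ hδ1 hτ hτ0 hτ1 hτE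
  have hin : ∀ (v : 𝔼 n) i, inner ℝ v (EuclideanSpace.single i (1 : ℝ)) = v i := fun v i => by
    simp [EuclideanSpace.inner_single_right]
  -- Up to `δ`, each `ω i` has slope between `0` and `1` along its axis, so subtracting it does not
  -- expand the `i`-th coordinate; near `E` the slope is about `1` and the coordinate is nearly
  -- constant.
  let Φ : (𝔼 n) → 𝔼 n := fun x => WithLp.toLp 2 fun i => x i - ω i x
  have hΦ : ∀ x i, Φ x i = x i - ω i x := fun x i => rfl
  refine ⟨Φ, fun x => ?_, fun x y => ?_, fun x hx => ?_⟩
  · have := norm_le_of_forall_abs_le (u := Φ x - x) (v := 0) (c := δ * τ x)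
      (mul_nonneg hδ.le (hτ0 x)) fun i => by
        rw [PiLp.sub_apply, hΦ, sub_sub_cancel_left, abs_neg, abs_of_nonneg (h0 i x)]
        simpa using h1 i x
    rw [norm_zero, zero_add] at this
    linarith
  · have := norm_le_of_forall_abs_le (u := Φ y - Φ x) (v := y - x) (c := δ * ‖y - x‖)
      (by positivity) fun i => by
        have h4 := h2 i x y
        have h5 := h2 i y x
        rw [hin, PiLp.sub_apply] at h4 h5
        rw [norm_sub_rev] at h5
        rw [PiLp.sub_apply, hΦ, hΦ, PiLp.sub_apply]
        rcases le_total 0 (y i - x i) with h | h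
        · rw [max_eq_left h] at h4
          rw [max_eq_right (by linarith)] at h5
          rw [abs_of_nonneg h, abs_le]
          constructor <;> linarith
        · rw [max_eq_right h] at h4
          rw [max_eq_left (by linarith)] at h5
          rw [abs_of_nonpos h, abs_le]
          constructor <;> linarith
    linarith
  · choose r hr0 hr using fun i : Fin n => h3 i x hx
    obtain ⟨ρ, hρ0, hρ⟩ : ∃ ρ > 0, ∀ i, ρ ≤ r i := by
      simpa using exists_pos_forall_mem_le Finset.univ hr0
    refine ⟨ρ, hρ0, fun y hy z hz => ?_⟩
    have := norm_le_of_forall_abs_le (u := Φ y - Φ z) (v := 0) (c := δ * ‖y - z‖)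
      (by positivity) fun i => by
        have h4 := hr i y (Metric.ball_subset_ball (hρ i) hy) z (Metric.ball_subset_ball (hρ i) hz)
        rw [hin, PiLp.sub_apply] at h4
        rw [PiLp.sub_apply, hΦ, hΦ, ← abs_neg]
        simp only [PiLp.zero_apply, abs_zero, zero_add]
        convert h4 using 2
        ring
    rw [norm_zero, zero_add] at this
    linarith

/-- A function with Lipschitz constant `c < c'` can be changed slightly into one which has Lipschitz
constant `c'` and is close to an affine function of slope `e` in neighbourhoods of the points
of `E`; here `e` is any vector of norm `< c'`. -/
theorem UniformlyPurelyUnrectifiable.exists_nearlyAffineAt {E : Set (𝔼 n)}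
    (hE : UniformlyPurelyUnrectifiable E) {f : (𝔼 n) → ℝ} {c c' : ℝ} (hc0 : 0 ≤ c) (hcc' : c < c')
    (hc' : c' ≤ 1) (hf : ∀ x y, |f y - f x| ≤ c * ‖y - x‖) {e : 𝔼 n} (he : ‖e‖ < c')
    {ε : ℝ} (hε : 0 < ε) {τ : (𝔼 n) → ℝ} (hτ : LipschitzWith 1 τ) (hτ0 : ∀ x, 0 ≤ τ x)
    (hτ1 : ∀ x, τ x ≤ 1) (hτE : ∀ x ∈ E, 0 < τ x) :
    ∃ g : (𝔼 n) → ℝ, (∀ x y, |g y - g x| ≤ c' * ‖y - x‖) ∧ (∀ x, |g x - f x| ≤ τ x) ∧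
      ∀ x ∈ E, NearlyAffineAt e ε g x := by
  obtain ⟨κ, hκ0, hκ⟩ : ∃ κ > 0, κ ≤ c' - c ∧ κ ≤ c' - ‖e‖ ∧ κ ≤ ε ∧ κ ≤ 1 / 2 :=
    ⟨min (min (c' - c) (c' - ‖e‖)) (min ε (1 / 2)), by
      simp only [gt_iff_lt, lt_min_iff]; exact ⟨⟨by linarith, by linarith⟩, hε, by norm_num⟩,
      (min_le_left _ _).trans (min_le_left _ _), (min_le_left _ _).trans (min_le_right _ _),
      (min_le_right _ _).trans (min_le_left _ _), (min_le_right _ _).trans (min_le_right _ _)⟩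
  obtain ⟨hκ1, hκ2, hκ3, hκ4⟩ := hκ
  obtain ⟨δ, hδ0, hδ⟩ : ∃ δ > 0, n * δ + δ ≤ κ :=
    ⟨κ / (n + 1), by positivity, le_of_eq (by field_simp)⟩
  have hnδ : 0 ≤ n * δ := by positivity
  have hδ1 : δ ≤ 1 := by linarith
  obtain ⟨Φ, hΦ1, hΦ2, hΦ3⟩ := hE.exists_flattening hδ0 hδ1 hτ hτ0 hτ1 hτE
  let f₁ : (𝔼 n) → ℝ := fun x => f (Φ x)
  have hf₁ : ∀ x y, |f₁ y - f₁ x| ≤ (c + n * δ) * ‖y - x‖ := fun x y => by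
    refine (hf _ _).trans ((mul_le_mul_of_nonneg_left (hΦ2 x y) hc0).trans ?_)
    rw [← mul_assoc]
    gcongr
    nlinarith
  have hflat : ∀ x ∈ E, NearlyAffineAt 0 (n * δ) f₁ x := fun x hx => by
    obtain ⟨r, hr, h⟩ := hΦ3 x hx
    refine ⟨r, hr, fun y hy z hz => ?_⟩
    rw [inner_zero_right, sub_zero]
    refine (hf _ _).trans ((mul_le_of_le_one_left (norm_nonneg _) (by linarith)).trans ?_)
    exact h y hy z hz
  -- The bound `ω ≤ δ * d` confines `ω` to the open set where `f₁` is flat, so `c` and `‖e‖` never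
  -- add up. Inside, the pointwise constant is `n * δ + δ + ‖e‖`; outside, `ω` vanishes at `x` and
  -- grows at rate at most `δ`, giving `n * δ + δ + c`.
  obtain ⟨d, hd, hd0, hd1, hdV, hdV', -⟩ :=
    exists_lipschitzWith_ball_subset (isOpen_nearlyAffineAt 0 (n * δ) f₁)
  obtain ⟨ω, hω0, hω1, hω2, hω3⟩ := hE.exists_potential_le_of_norm_le_one (e := e) (by linarith)
    hδ0 hδ1 (τ := fun x => min (τ x) (d x)) (by simpa using hτ.min hd)
    (fun x => le_min (hτ0 x) (hd0 x)) (fun x => (min_le_left _ _).trans (hτ1 x))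
    (fun x hx => lt_min (hτE x hx) (hdV x (hflat x hx)))
  have hωτ : ∀ x, ω x ≤ δ * τ x := fun x =>
    (hω1 x).trans (mul_le_mul_of_nonneg_left (min_le_left _ _) hδ0.le)
  have hωd : ∀ x, ω x ≤ δ * d x := fun x =>
    (hω1 x).trans (mul_le_mul_of_nonneg_left (min_le_right _ _) hδ0.le)
  have hωL : ∀ x y, |ω y - ω x| ≤ (‖e‖ + δ) * ‖y - x‖ := by
    have key : ∀ x y, ω y - ω x ≤ (‖e‖ + δ) * ‖y - x‖ := fun x y => by
      refine (hω2 x y).trans ?_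
      rw [add_mul]
      gcongr
      exact max_le ((real_inner_le_norm _ _).trans_eq (mul_comm _ _)) (by positivity)
    intro x y
    refine abs_le.2 ⟨?_, key x y⟩
    have := key y x
    rw [norm_sub_rev] at this
    linarith
  refine ⟨fun x => f₁ x + ω x, fun x y => ?_, fun x => ?_, fun x hx => ?_⟩
  · refine abs_sub_le_of_forall_pointwise (f := fun x => f₁ x + ω x) convex_univ
      (fun x _ => ?_) (mem_univ x) (mem_univ y)
    by_cases hx : NearlyAffineAt 0 (n * δ) f₁ x
    · obtain ⟨r, hr, h⟩ := hx
      refine ⟨r, hr, fun y hy => ?_⟩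
      have h1 := h y hy x (Metric.mem_ball_self hr)
      rw [inner_zero_right, sub_zero] at h1
      have h2 := hωL x y
      calc |f₁ y + ω y - (f₁ x + ω x)| = |(f₁ y - f₁ x) + (ω y - ω x)| := by congr 1; ring
        _ ≤ n * δ * ‖y - x‖ + (‖e‖ + δ) * ‖y - x‖ := (abs_add_le _ _).trans (add_le_add h1 h2)
        _ = (n * δ + δ + ‖e‖) * ‖y - x‖ := by ring
        _ ≤ c' * ‖y - x‖ := by gcongr; linarith
    · refine ⟨1, one_pos, fun y _ => ?_⟩
      have hdx : d x = 0 := hdV' x hx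
      have hωx : ω x = 0 := le_antisymm (by simpa [hdx] using hωd x) (hω0 x)
      have hdy : d y ≤ ‖y - x‖ := by
        have := hd.dist_le_mul y x
        rw [Real.dist_eq, hdx, sub_zero, abs_of_nonneg (hd0 y), dist_eq_norm] at this
        simpa using this
      have hωy : |ω y| ≤ δ * ‖y - x‖ := by
        rw [abs_of_nonneg (hω0 y)]
        exact (hωd y).trans (by gcongr)
      calc |f₁ y + ω y - (f₁ x + ω x)| = |(f₁ y - f₁ x) + ω y| := by rw [hωx]; congr 1; ring
        _ ≤ (c + n * δ) * ‖y - x‖ + δ * ‖y - x‖ :=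
          (abs_add_le _ _).trans (add_le_add (hf₁ x y) hωy)
        _ = (n * δ + δ + c) * ‖y - x‖ := by ring
        _ ≤ c' * ‖y - x‖ := by gcongr; linarith
  · have h1 : |f₁ x - f x| ≤ n * δ * τ x :=
      (hf _ _).trans ((mul_le_of_le_one_left (norm_nonneg _) (by linarith)).trans (hΦ1 x))
    have h2 : |ω x| ≤ δ * τ x := by rw [abs_of_nonneg (hω0 x)]; exact hωτ x
    calc |f₁ x + ω x - f x| = |(f₁ x - f x) + ω x| := by congr 1; ring
      _ ≤ n * δ * τ x + δ * τ x := (abs_add_le _ _).trans (add_le_add h1 h2)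
      _ = (n * δ + δ) * τ x := by ring
      _ ≤ τ x := mul_le_of_le_one_left (hτ0 x) (by linarith)
  · obtain ⟨r₁, hr₁, h₁⟩ := hflat x hx
    obtain ⟨r₂, hr₂, h₂⟩ := hω3 x hx
    refine ⟨min r₁ r₂, lt_min hr₁ hr₂, fun y hy z hz => ?_⟩
    have h3 := h₁ y (Metric.ball_subset_ball (min_le_left _ _) hy) z
      (Metric.ball_subset_ball (min_le_left _ _) hz)
    have h4 := h₂ y (Metric.ball_subset_ball (min_le_right _ _) hy) z
      (Metric.ball_subset_ball (min_le_right _ _) hz)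
    rw [inner_zero_right, sub_zero] at h3
    calc |f₁ y + ω y - (f₁ z + ω z) - inner ℝ (y - z) e|
        = |(f₁ y - f₁ z) + (ω y - ω z - inner ℝ (y - z) e)| := by congr 1; ring
      _ ≤ n * δ * ‖y - z‖ + δ * ‖y - z‖ := (abs_add_le _ _).trans (add_le_add h3 h4)
      _ = (n * δ + δ) * ‖y - z‖ := by ring
      _ ≤ ε * ‖y - z‖ := by gcongr; linarith

/-- The data produced by one step of the construction: `g` is nearly affine with slope `e` at some
small scale around each point of `E`, and this is not affected by perturbations bounded by `σ`. -/
theorem UniformlyPurelyUnrectifiable.exists_step {E : Set (𝔼 n)}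
    (hE : UniformlyPurelyUnrectifiable E) {f : (𝔼 n) → ℝ} {c c' : ℝ} (hc0 : 0 ≤ c) (hcc' : c < c')
    (hc' : c' ≤ 1) (hf : ∀ x y, |f y - f x| ≤ c * ‖y - x‖) {e : 𝔼 n} (he : ‖e‖ < c')
    {ε : ℝ} (hε : 0 < ε) (hε1 : ε ≤ 1) {τ : (𝔼 n) → ℝ} (hτ : LipschitzWith 1 τ)
    (hτ0 : ∀ x, 0 ≤ τ x) (hτ1 : ∀ x, τ x ≤ 1) (hτE : ∀ x ∈ E, 0 < τ x) :
    ∃ g σ : (𝔼 n) → ℝ, (∀ x y, |g y - g x| ≤ c' * ‖y - x‖) ∧ (∀ x, |g x - f x| ≤ τ x) ∧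
      LipschitzWith 1 σ ∧ (∀ x, 0 ≤ σ x) ∧ (∀ x, σ x ≤ 1 / 2 * τ x) ∧ (∀ x ∈ E, 0 < σ x) ∧
      ∀ x ∈ E, ∃ r > 0, r ≤ ε ∧ ∀ y, ‖y‖ ≤ r →
        |g (x + y) - g x - inner ℝ e y| ≤ ε * r ∧ σ x + σ (x + y) ≤ ε * r := by
  obtain ⟨g, hg1, hg2, hg3⟩ := hE.exists_nearlyAffineAt hc0 hcc' hc' hf he hε hτ hτ0 hτ1 hτE
  obtain ⟨d, hd, hd0, hd1, hdV, -, hdb⟩ :=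
    exists_lipschitzWith_ball_subset (isOpen_nearlyAffineAt e ε g)
  -- With `r = ε * d x / 2` one has `d (x + y) ≤ 2 * d x`, so the two values of `σ` sum to at most
  -- `3 / 8 * ε ^ 2 * d x ≤ ε * r`.
  refine ⟨g, fun x => min (1 / 2 * τ x) (ε ^ 2 / 8 * d x), hg1, hg2, ?_, fun x => ?_,
    fun x => min_le_left _ _, fun x hx => ?_, fun x hx => ?_⟩
  · simpa using (LipschitzWith.one_const_mul hτ (by norm_num) (by norm_num)).min
      (LipschitzWith.one_const_mul hd (c := ε ^ 2 / 8) (by positivity) (by nlinarith))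
  · exact le_min (mul_nonneg (by norm_num) (hτ0 x)) (mul_nonneg (by positivity) (hd0 x))
  · exact lt_min (mul_pos (by norm_num) (hτE x hx)) (mul_pos (by positivity) (hdV x (hg3 x hx)))
  · have hdx : 0 < d x := hdV x (hg3 x hx)
    refine ⟨ε * d x / 2, by positivity, by nlinarith [hd1 x], fun y hy => ?_⟩
    have hyd : ‖y‖ ≤ d x / 2 := hy.trans (by nlinarith)
    have hdy : d (x + y) ≤ d x + ‖y‖ := by
      have := (le_abs_self _).trans (hd.dist_le_mul (x + y) x)
      rw [dist_eq_norm, add_sub_cancel_left, NNReal.coe_one, one_mul] at this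
      linarith
    constructor
    · have h1 := NearlyAffineAt.of_ball (fun y hy => hdb x hy) (y := x + y) (z := x)
        (by rw [Metric.mem_ball, dist_eq_norm, add_sub_cancel_left]; linarith)
        (Metric.mem_ball_self hdx)
      rw [add_sub_cancel_left, real_inner_comm] at h1
      exact h1.trans (by gcongr)
    · have h1 : min (1 / 2 * τ x) (ε ^ 2 / 8 * d x) ≤ ε ^ 2 / 8 * d x := min_le_right _ _
      have h2 : min (1 / 2 * τ (x + y)) (ε ^ 2 / 8 * d (x + y)) ≤ ε ^ 2 / 8 * (2 * d x) :=
        (min_le_right _ _).trans (by gcongr; linarith)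
      have h3 : 0 < ε ^ 2 * d x := by positivity
      nlinarith

/-! ### The iteration -/

theorem exists_seq_of_forall_step {β : Type*} (P : ℕ → β → Prop) (R : ℕ → β → β → Prop)
    (h0 : ∃ a, P 0 a) (hstep : ∀ k a, P k a → ∃ b, P (k + 1) b ∧ R k a b) :
    ∃ s : ℕ → β, ∀ k, P k (s k) ∧ R k (s k) (s (k + 1)) := by
  obtain ⟨a, ha⟩ := h0
  choose! F hF1 hF2 using hstep
  let s : ℕ → β := fun k => Nat.rec a F k
  have hs : ∀ k, P k (s k) := fun k => by
    induction k with
    | zero => exact ha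
    | succ k ih => exact hF1 k _ ih
  exact ⟨s, fun k => ⟨hs k, hF2 k _ (hs k)⟩⟩

/-- A `1`-Lipschitz function such that near the points of `E` each linear form of norm at most `1`
is its approximate derivative along a sequence of scales. -/
theorem UniformlyPurelyUnrectifiable.exists_lipschitzWith_frequently {E : Set (𝔼 n)}
    (hE : UniformlyPurelyUnrectifiable E) :
    ∃ f : (𝔼 n) → ℝ, LipschitzWith 1 f ∧ ∀ x ∈ E, ∀ e : 𝔼 n, ‖e‖ ≤ 1 → ∀ δ > 0,
      ∃ᶠ r in 𝓝[>] (0 : ℝ), ∀ y, ‖y‖ ≤ r → |f (x + y) - f x - inner ℝ e y| ≤ δ * r := by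
  have : Nonempty (Metric.closedBall (0 : 𝔼 n) 1) := ⟨⟨0, by simp⟩⟩
  let q : ℕ → Metric.closedBall (0 : 𝔼 n) 1 := TopologicalSpace.denseSeq _
  have hq : ∀ j, ‖(q j : 𝔼 n)‖ ≤ 1 := fun j => mem_closedBall_zero_iff.1 (q j).2
  let ε : ℕ → ℝ := fun k => 1 / ((k : ℝ) + 1)
  have hε0 : ∀ k, 0 < ε k := fun k => by positivity
  have hε1 : ∀ k, ε k ≤ 1 := fun k => by
    rw [div_le_one (by positivity)]
    linarith [k.cast_nonneg (α := ℝ)]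
  have hεs : ∀ k, ε (k + 1) < ε k := fun k => Nat.one_div_lt_one_div k.lt_succ_self
  have hεlim : Tendsto ε atTop (𝓝 0) := tendsto_one_div_add_atTop_nhds_zero_nat
  let c : ℕ → ℝ := fun k => 1 - ε k
  -- Unpairing makes every `q j` recur infinitely often; the factor `c k` ensures `‖v k‖ < c (k +
  -- 1)`, as a step requires. Since `c 0 = 0`, the iteration starts from the zero function.
  let v : ℕ → 𝔼 n := fun k => c k • (q k.unpair.1 : 𝔼 n)
  have hc0 : ∀ k, 0 ≤ c k := fun k => sub_nonneg.2 (hε1 k)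
  have hv : ∀ k, ‖v k‖ ≤ c k := fun k => by
    rw [norm_smul, Real.norm_of_nonneg (hc0 k)]
    exact mul_le_of_le_one_right (hc0 k) (hq _)
  obtain ⟨s, hs⟩ := exists_seq_of_forall_step (β := ((𝔼 n) → ℝ) × ((𝔼 n) → ℝ))
    (fun k a => (∀ x y, |a.1 y - a.1 x| ≤ c k * ‖y - x‖) ∧ LipschitzWith 1 a.2 ∧
      (∀ x, 0 ≤ a.2 x) ∧ (∀ x, a.2 x ≤ 1) ∧ ∀ x ∈ E, 0 < a.2 x)
    (fun k a b => (∀ x, |b.1 x - a.1 x| ≤ a.2 x) ∧ (∀ x, b.2 x ≤ 1 / 2 * a.2 x) ∧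
      ∀ x ∈ E, ∃ r > 0, r ≤ ε k ∧ ∀ y, ‖y‖ ≤ r →
        |b.1 (x + y) - b.1 x - inner ℝ (v k) y| ≤ ε k * r ∧ b.2 x + b.2 (x + y) ≤ ε k * r)
    ⟨(fun _ => 0, fun _ => 1), fun x y => by simpa using mul_nonneg (hc0 0) (norm_nonneg _),
      LipschitzWith.const' 1, by simp, by simp, by simp⟩
    (by
      rintro k ⟨f, τ⟩ ⟨h1, h2, h3, h4, h5⟩
      have hcs : c k < c (k + 1) := sub_lt_sub_left (hεs k) 1
      obtain ⟨g, σ, g1, g2, g3, g4, g5, g6, g7⟩ := hE.exists_step (hc0 k) hcs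
        (sub_le_self 1 (hε0 _).le) h1 ((hv k).trans_lt hcs) (hε0 k) (hε1 k) h2 h3 h4 h5
      exact ⟨(g, σ), ⟨g1, g3, g4, fun x => by linarith [g5 x, h4 x], g6⟩, g2, g5, g7⟩)
  have hτ0 : ∀ k x, 0 ≤ (s k).2 x := fun k => (hs k).1.2.2.1
  have hτs : ∀ k x, (s (k + 1)).2 x ≤ 1 / 2 * (s k).2 x := fun k => (hs k).2.2.1
  have hτ : ∀ k x, (s k).2 x ≤ (1 / 2) ^ k := fun k x => by
    induction k with
    | zero => simpa using (hs 0).1.2.2.2.1 x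
    | succ k ih =>
      rw [pow_succ']
      exact (hτs k x).trans (by gcongr)
  have hfs : ∀ k x, |(s (k + 1)).1 x - (s k).1 x| ≤ (s k).2 x := fun k => (hs k).2.1
  have hlim : ∀ x, ∃ l, Tendsto (fun k => (s k).1 x) atTop (𝓝 l) := fun x =>
    cauchySeq_tendsto_of_complete <| cauchySeq_of_le_geometric (1 / 2) 1 (by norm_num) fun k => by
      rw [dist_comm, Real.dist_eq, one_mul]
      exact (hfs k x).trans (hτ k x)
  choose f hf using hlim
  have htail : ∀ k x, |f x - (s k).1 x| ≤ 2 * (s k).2 x := by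
    intro k x
    -- Subtracting the unused tail `2 * (s (j + k)).2 x` makes the induction close, because `τ` at
    -- least halves at each step.
    have hj : ∀ j, |(s (j + k)).1 x - (s k).1 x| ≤ 2 * (s k).2 x - 2 * (s (j + k)).2 x := by
      intro j
      induction j with
      | zero => simp
      | succ j ih =>
        have h1 := hfs (j + k) x
        have h2 := hτs (j + k) x
        have h3 := abs_sub_le ((s (j + k + 1)).1 x) ((s (j + k)).1 x) ((s k).1 x)
        rw [show j + 1 + k = j + k + 1 by ring]
        linarith
    refine le_of_tendsto' (((hf x).comp (tendsto_add_atTop_nat k)).sub_const _).abs fun j => ?_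
    exact (hj j).trans (by linarith [hτ0 (j + k) x])
  refine ⟨f, LipschitzWith.of_dist_le_mul fun x y => ?_, fun x hx e he δ hδ => ?_⟩
  · rw [Real.dist_eq, NNReal.coe_one, one_mul, dist_eq_norm]
    refine le_of_tendsto' ((hf x).sub (hf y)).abs fun k => ((hs k).1.1 y x).trans ?_
    exact mul_le_of_le_one_left (norm_nonneg _) (sub_le_self 1 (hε0 k).le)
  · refine (nhdsGT_basis (0 : ℝ)).frequently_iff.2 fun {ρ} hρ => ?_
    obtain ⟨j, hj⟩ := (TopologicalSpace.denseRange_denseSeq _).exists_dist_lt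
      (⟨e, by simpa using he⟩ : Metric.closedBall (0 : 𝔼 n) 1) (show 0 < δ / 2 by positivity)
    have hj : ‖e - q j‖ < δ / 2 := by rw [← dist_eq_norm]; exact hj
    -- The error at scale `r` will be `ε k * r` from the step, `2 * ε k * r` from later corrections
    -- and `(δ / 2 + ε k) * r` from replacing `v k` by `e`; hence `δ / 8`.
    obtain ⟨m, hm⟩ := (hεlim.eventually (gt_mem_nhds
      (show 0 < min (δ / 8) ρ from lt_min (by positivity) hρ))).exists
    set k := Nat.pair j m with hk
    have hεk : ε k < min (δ / 8) ρ :=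
      lt_of_le_of_lt (Nat.one_div_le_one_div (Nat.right_le_pair j m)) hm
    obtain ⟨hεk1, hεk2⟩ := lt_min_iff.1 hεk
    have hvk : ‖v k - e‖ ≤ δ / 2 + ε k := by
      have h1 : v k - e = -(e - q j) - ε k • (q j : 𝔼 n) := by
        simp only [v, c, hk, Nat.unpair_pair, sub_smul, one_smul]; abel
      rw [h1]
      refine (norm_sub_le _ _).trans ?_
      rw [norm_neg, norm_smul, Real.norm_of_nonneg (hε0 k).le]
      exact add_le_add hj.le (mul_le_of_le_one_right (hε0 k).le (hq j))
    obtain ⟨r, hr0, hrε, hr⟩ := (hs k).2.2.2 x hx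
    refine ⟨r, ⟨hr0, hrε.trans_lt hεk2⟩, fun y hy => ?_⟩
    obtain ⟨h1, h2⟩ := hr y hy
    have h3 := htail (k + 1) x
    have h4 := htail (k + 1) (x + y)
    have h5 : |inner ℝ (v k - e) y| ≤ (δ / 2 + ε k) * r :=
      (abs_real_inner_le_norm _ _).trans
        (mul_le_mul hvk hy (norm_nonneg _) ((norm_nonneg _).trans hvk))
    rw [inner_sub_left] at h5
    have h6 := mul_lt_mul_of_pos_right hεk1 hr0
    rw [abs_le] at h1 h3 h4 h5 ⊢
    constructor <;> nlinarith

/-! ### Consequences for the derivatives -/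

theorem liminf_linearApproxError_eq_zero {f : (𝔼 n) → ℝ} {x e : 𝔼 n}
    (h : ∀ δ > 0, ∃ᶠ r in 𝓝[>] (0 : ℝ), ∀ y, ‖y‖ ≤ r →
      |f (x + y) - f x - inner ℝ e y| ≤ δ * r) :
    liminf (fun r : ℝ => linearApproxError f x e r) (𝓝[>] 0) = 0 := by
  refine le_antisymm (ENNReal.le_of_forall_pos_le_add fun δ hδ _ => ?_) zero_le
  rw [zero_add]
  refine liminf_le_of_frequently_le' ?_
  refine ((h δ hδ).and_eventually self_mem_nhdsWithin).mono fun r hr => ?_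
  obtain ⟨hr, hr0⟩ := hr
  refine iSup₂_le fun y hy => ?_
  rw [← ENNReal.ofReal_coe_nnreal]
  exact ENNReal.ofReal_le_ofReal ((div_le_iff₀ hr0).2 (hr y hy))

/-- Test the slope `e = s • y / ‖y‖` on the multiple of `y` of length `r`, that is, at `t = r /
‖y‖`. The values `s = 1` and `s = -1` give the extreme derivatives. -/
theorem frequently_abs_slope_sub_le {f : (𝔼 n) → ℝ} {x : 𝔼 n}
    (h : ∀ e : 𝔼 n, ‖e‖ ≤ 1 → ∀ δ > 0, ∃ᶠ r in 𝓝[>] (0 : ℝ), ∀ y, ‖y‖ ≤ r →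
      |f (x + y) - f x - inner ℝ e y| ≤ δ * r) (y : 𝔼 n) {s : ℝ} (hs : |s| ≤ 1) {δ : ℝ}
    (hδ : 0 < δ) :
    ∃ᶠ t in 𝓝[>] (0 : ℝ), |(f (x + t • y) - f x) / t - s * ‖y‖| ≤ δ := by
  rcases eq_or_ne y 0 with rfl | hy
  · exact (Eventually.of_forall fun t => by simpa using hδ.le).frequently
  have hy0 : 0 < ‖y‖ := norm_pos_iff.2 hy
  refine (nhdsGT_basis (0 : ℝ)).frequently_iff.2 fun {ρ} hρ => ?_
  have he : ‖s • ‖y‖⁻¹ • y‖ ≤ 1 := by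
    rw [norm_smul, norm_smul, norm_inv, norm_norm, inv_mul_cancel₀ hy0.ne', mul_one]
    exact hs
  obtain ⟨r, ⟨hr0, hrρ⟩, hr⟩ := (nhdsGT_basis (0 : ℝ)).frequently_iff.1
    (h _ he (δ / ‖y‖) (by positivity)) _ (mul_pos hρ hy0)
  refine ⟨r / ‖y‖, ⟨by positivity, (div_lt_iff₀ hy0).2 hrρ⟩, ?_⟩
  have ht : 0 < r / ‖y‖ := by positivity
  have h1 := hr ((r / ‖y‖) • y) (by
    rw [norm_smul, Real.norm_of_nonneg ht.le, div_mul_cancel₀ _ hy0.ne'])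
  rw [real_inner_smul_left, real_inner_smul_left, real_inner_smul_right,
    real_inner_self_eq_norm_sq] at h1
  have h2 : s * (‖y‖⁻¹ * (r / ‖y‖ * ‖y‖ ^ 2)) = s * ‖y‖ * (r / ‖y‖) := by field_simp
  have h3 : δ / ‖y‖ * r = δ * (r / ‖y‖) := by ring
  rw [h2, h3] at h1
  rw [div_sub' ht.ne', abs_div, abs_of_pos ht, div_le_iff₀ ht, mul_comm (r / ‖y‖) (s * ‖y‖)]
  exact h1

theorem abs_slope_le {f : (𝔼 n) → ℝ} (hf : LipschitzWith 1 f) (x y : 𝔼 n) {t : ℝ} (ht : 0 < t) :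
    |(f (x + t • y) - f x) / t| ≤ ‖y‖ := by
  rw [abs_div, abs_of_pos ht, div_le_iff₀ ht]
  simpa [Real.dist_eq, dist_eq_norm, norm_smul, abs_of_pos ht, mul_comm] using
    hf.dist_le_mul (x + t • y) x

theorem upperDirDeriv_eq_norm {f : (𝔼 n) → ℝ} (hf : LipschitzWith 1 f) {x y : 𝔼 n}
    (h : ∀ δ > 0, ∃ᶠ t in 𝓝[>] (0 : ℝ), |(f (x + t • y) - f x) / t - ‖y‖| ≤ δ) :
    upperDirDeriv f x y = ((‖y‖ : ℝ) : EReal) := by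
  refine le_antisymm (limsup_le_of_le (by isBoundedDefault) ?_)
    (EReal.ge_of_forall_gt_iff_ge.1 fun c hc => le_limsup_of_frequently_le' ?_)
  · filter_upwards [self_mem_nhdsWithin] with t ht
    exact EReal.coe_le_coe_iff.2 (abs_le.1 (abs_slope_le hf x y ht)).2
  · refine (h (‖y‖ - c) (sub_pos.2 (EReal.coe_lt_coe_iff.1 hc))).mono fun t ht => ?_
    exact EReal.coe_le_coe_iff.2 (by linarith [(abs_le.1 ht).1])

theorem lowerDirDeriv_eq_neg_norm {f : (𝔼 n) → ℝ} (hf : LipschitzWith 1 f) {x y : 𝔼 n}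
    (h : ∀ δ > 0, ∃ᶠ t in 𝓝[>] (0 : ℝ), |(f (x + t • y) - f x) / t + ‖y‖| ≤ δ) :
    lowerDirDeriv f x y = ((-‖y‖ : ℝ) : EReal) := by
  refine le_antisymm
    (EReal.le_of_forall_lt_iff_le.1 fun c hc => liminf_le_of_frequently_le' ?_)
    (le_liminf_of_le (by isBoundedDefault) ?_)
  · refine (h (c + ‖y‖) (by linarith [EReal.coe_lt_coe_iff.1 hc])).mono fun t ht => ?_
    exact EReal.coe_le_coe_iff.2 (by linarith [(abs_le.1 ht).2])
  · filter_upwards [self_mem_nhdsWithin] with t ht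
    exact EReal.coe_le_coe_iff.2 (abs_le.1 (abs_slope_le hf x y ht)).1

end ConeWidth

theorem theorem9 (n : ℕ) (E : Set (EuclideanSpace ℝ (Fin n)))
    (hE : ConeWidth.UniformlyPurelyUnrectifiable E) :
    ∃ f : EuclideanSpace ℝ (Fin n) → ℝ,
      LipschitzWith 1 f ∧
      (∀ x ∈ E, ∀ e : EuclideanSpace ℝ (Fin n), ‖e‖ ≤ 1 →
        Filter.liminf (fun r : ℝ => ConeWidth.linearApproxError f x e r)
          (nhdsWithin (0 : ℝ) (Set.Ioi 0)) = 0) ∧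
      (∀ x ∈ E, ∀ y : EuclideanSpace ℝ (Fin n),
        ConeWidth.upperDirDeriv f x y = ((‖y‖ : ℝ) : EReal) ∧
        ConeWidth.lowerDirDeriv f x y = ((-‖y‖ : ℝ) : EReal)) := by
  obtain ⟨f, hf, h⟩ := hE.exists_lipschitzWith_frequently
  refine ⟨f, hf, fun x hx e he => ConeWidth.liminf_linearApproxError_eq_zero (h x hx e he),
    fun x hx y => ⟨ConeWidth.upperDirDeriv_eq_norm hf fun δ hδ => ?_,
      ConeWidth.lowerDirDeriv_eq_neg_norm hf fun δ hδ => ?_⟩⟩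
  · simpa using ConeWidth.frequently_abs_slope_sub_le (h x hx) y (s := 1) (by simp) hδ
  · simpa using ConeWidth.frequently_abs_slope_sub_le (h x hx) y (s := -1) (by simp) hδ
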